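/- Let $G=(V,E)$ be a finite simple connected graph. A bijection $f:E\to\{1,\dots,|E|\}$ is a \emph{local antimagic labeling} of $G$ if $f^+(u)\neq f^+(v)$ for all adjacent vertices $u,v$, where $f^+(u)$ is the sum of $f(e)$ over all edges $e$ incident to $u$. Let $c(f)$ be the number of distinct values of $f^+$ on $V$, and let the \emph{local antimagic chromatic number} $\chi_{la}(G)$ be the minimum of $c(f)$ over all local antimagic labelings $f$ of $G$. Let $C_m$ be the cycle of order $m$, let $O_n$ be the null graph (no edges) of order $n$, and let the \emph{corona} $C_m\odot O_n$ be the graph obtained from $C_m$ and $m$ copies of $O_n$ by joining the $i$-th vertex of $C_m$ to each vertex of the $i$-th copy of $O_n$, $1\le i\le m$. \textbf{Theorem.} Let $m\ge 3$ and $n\ge 1$. If $m$ and $n$ are both even, then $\chi_{la}(C_m\odot O_n)=mn+2$. Otherwise, $mn+2\le\chi_{la}(C_m\odot O_n)\le mn+3$. -/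

import Mathlib

namespace SimpleGraph

/-- The corona product `G ⊙ H`: one copy of `G` (the vertices `inl v`) and, for every vertex `v`
of `G`, one copy of `H` (the vertices `inr (v, w)`, `w` a vertex of `H`); the vertex `v` of `G` is
joined to each vertex of the `v`-th copy of `H`. -/
def corona {V W : Type*} (G : SimpleGraph V) (H : SimpleGraph W) : SimpleGraph (V ⊕ V × W) where
  Adj x y :=
    match x, y with
    | Sum.inl u, Sum.inl v => G.Adj u v
    | Sum.inl u, Sum.inr p => u = p.1
    | Sum.inr p, Sum.inl u => p.1 = u
    | Sum.inr p, Sum.inr q => p.1 = q.1 ∧ H.Adj p.2 q.2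
  symm := ⟨by
    rintro (u | p) (v | q) h
    · exact SimpleGraph.Adj.symm h
    · exact Eq.symm h
    · exact Eq.symm h
    · exact ⟨h.1.symm, SimpleGraph.Adj.symm h.2⟩⟩
  loopless := ⟨by
    rintro (u | p) h
    · exact G.irrefl h
    · exact H.irrefl h.2⟩

variable {V : Type*} [Fintype V]

open Classical in
/-- The induced vertex label `f⁺(v) = ∑ f(e)`, the sum over all edges `e` of `G` incident to `v`.
(The values of `f` off the edge set of `G` are never used.) -/
noncomputable def inducedLabel (G : SimpleGraph V) (f : Sym2 V → ℕ) (v : V) : ℕ :=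
  ∑ e ∈ G.incidenceFinset v, f e

/-- `f` is a local antimagic labeling of `G`: a bijection from the edge set `E` of `G` onto
`{1, …, |E|}` such that adjacent vertices have distinct induced labels. -/
def IsLocalAntimagicLabeling (G : SimpleGraph V) (f : Sym2 V → ℕ) : Prop :=
  Set.BijOn f G.edgeSet (Set.Icc 1 G.edgeSet.ncard) ∧
    ∀ u v : V, G.Adj u v → G.inducedLabel f u ≠ G.inducedLabel f v

/-- The color number `c(f)`: the number of distinct induced vertex labels. -/
noncomputable def colorNumber (G : SimpleGraph V) (f : Sym2 V → ℕ) : ℕ :=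
  (Set.range (G.inducedLabel f)).ncard

/-- The local antimagic chromatic number `χ_la(G)`: the minimum of `c(f)` over all local antimagic
labelings `f` of `G` (and `⊤` if `G` has none). -/
noncomputable def localAntimagicChromaticNumber (G : SimpleGraph V) : ℕ∞ :=
  ⨅ (f : Sym2 V → ℕ) (_ : G.IsLocalAntimagicLabeling f), (G.colorNumber f : ℕ∞)

end SimpleGraph

/-! Write N = mn + m for the number of edges. The pendant vertices carry mn distinct colors, all at
most N, so the lower bound needs two distinct center labels above N
(`exists_two_large_centerLabels`). If these fail to exist, the centers with label at most N form a
vertex cover S of the cycle, and their labels sum to at most |S|N. That sum contains every cycle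
edge and all n|S| pendant edges at S, and distinctness of the labels makes it too large.

Each center label exceeds its pendant labels, so for the upper bound it suffices to color the
centers properly with two or three colors. Explicit labelings do this for n = 1 and n = 2, and
`HasCoronaLabeling.add_two` raises n by 2. -/

/-! ### Explicit labelings -/

/-- A labeling of `C_m ⊙ O_n`, indexed by natural numbers: `x i` is the label of the cycle edge
from `i` to `i + 1` (modulo `m`), `p i j` the label of the `j`-th pendant edge at `i`. The labels
are distinct and at most `m * n + m`, the `i`-th cycle vertex has induced label `c i ∈ K`, and
adjacent cycle vertices have distinct induced labels. -/
structure IsCoronaLabeling (m n : ℕ) (x : ℕ → ℕ) (p : ℕ → ℕ → ℕ) (c : ℕ → ℕ) (K : Finset ℕ) :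
    Prop where
  cycle_mem : ∀ i < m, 1 ≤ x i ∧ x i ≤ m * n + m
  pendant_mem : ∀ i < m, ∀ j < n, 1 ≤ p i j ∧ p i j ≤ m * n + m
  cycle_inj : ∀ i < m, ∀ i' < m, x i = x i' → i = i'
  pendant_inj : ∀ i < m, ∀ j < n, ∀ i' < m, ∀ j' < n, p i j = p i' j' → i = i' ∧ j = j'
  cycle_ne_pendant : ∀ i < m, ∀ i' < m, ∀ j < n, x i ≠ p i' j
  sum_succ : ∀ i, i + 1 < m → x (i + 1) + x i + ∑ j ∈ Finset.range n, p (i + 1) j = c (i + 1)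
  sum_zero : x 0 + x (m - 1) + ∑ j ∈ Finset.range n, p 0 j = c 0
  color_mem : ∀ i < m, c i ∈ K
  color_ne : ∀ i, i + 1 < m → c (i + 1) ≠ c i
  color_ne_last : c 0 ≠ c (m - 1)

/-- `C_m ⊙ O_n` has a labeling in which the cycle vertices receive at most `k` colors. -/
def HasCoronaLabeling (m n k : ℕ) : Prop :=
  ∃ x p c K, IsCoronaLabeling m n x p c K ∧ K.card ≤ k

/-- Two further pendant edges with constant label sum can be added at every cycle vertex. -/
theorem HasCoronaLabeling.add_two {m n k : ℕ} (hm : 0 < m) (h : HasCoronaLabeling m n k) :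
    HasCoronaLabeling m (n + 2) k := by
  obtain ⟨x, p, c, K, h, hK⟩ := h
  -- The 2m new labels are paired as an increasing and a decreasing run, so each pair has the same
  -- sum.
  let q : ℕ → ℕ → ℕ := fun i j => if j < n then p i j else
    if j = n then m * n + m + 1 + i else m * n + 3 * m - i
  have hq (i j : ℕ) (hi : i < m) (hj : j < n + 2) :
      (j < n ∧ q i j = p i j) ∨ (j = n ∧ q i j = m * n + m + 1 + i) ∨
        (j = n + 1 ∧ q i j + i = m * n + 3 * m) := by
    rcases lt_trichotomy j n with h1 | h1 | h1
    · exact Or.inl ⟨h1, if_pos h1⟩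
    · exact Or.inr (Or.inl ⟨h1, by simp [q, h1]⟩)
    · refine Or.inr (Or.inr ⟨by omega, ?_⟩)
      simp only [q, if_neg h1.not_gt, if_neg h1.ne']
      omega
  have hqs (i : ℕ) (hi : i < m) : ∑ j ∈ Finset.range (n + 2), q i j =
      ∑ j ∈ Finset.range n, p i j + (2 * (m * n) + 4 * m + 1) := by
    have h0 : ∑ j ∈ Finset.range n, q i j = ∑ j ∈ Finset.range n, p i j :=
      Finset.sum_congr rfl fun j hj => if_pos (Finset.mem_range.1 hj)
    rw [Finset.sum_range_succ, Finset.sum_range_succ, h0]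
    have h1 := hq i n hi (by omega)
    have h2 := hq i (n + 1) hi (by omega)
    omega
  have hN : m * (n + 2) + m = m * n + 3 * m := by ring
  refine ⟨x, q, fun i => c i + (2 * (m * n) + 4 * m + 1),
    K.image (· + (2 * (m * n) + 4 * m + 1)), ?_, Finset.card_image_le.trans hK⟩
  constructor
  · intro i hi
    have := h.cycle_mem i hi
    omega
  · intro i hi j hj
    have h1 := hq i j hi hj
    have h2 := h.pendant_mem i hi j
    omega
  · exact h.cycle_inj
  · intro i hi j hj i' hi' j' hj' he
    have h1 := hq i j hi hj
    have h2 := hq i' j' hi' hj'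
    have h3 := h.pendant_mem i hi j
    have h4 := h.pendant_mem i' hi' j'
    have h5 := h.pendant_inj i hi j
    by_cases hjn : j < n
    · by_cases hjn' : j' < n
      · have := h5 hjn i' hi' j' hjn'
        omega
      · omega
    · omega
  · intro i hi i' hi' j hj he
    have h1 := hq i' j hi' hj
    have h2 := h.cycle_mem i hi
    have h3 := h.cycle_ne_pendant i hi i' hi' j
    omega
  · intro i hi
    have h1 := h.sum_succ i hi
    have h2 := hqs (i + 1) hi
    omega
  · have h1 := h.sum_zero
    have h2 := hqs 0 hm
    omega
  · exact fun i hi => Finset.mem_image_of_mem _ (h.color_mem i hi)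
  · intro i hi he
    exact h.color_ne i hi (by omega)
  · intro he
    exact h.color_ne_last (by omega)

/-- Interleaving two runs on the cycle makes the sum of the two cycle edges at i grow by 1 with i ≥
1. Pendant labels 2m - i would make the center labels constant there; swapping them within the pairs
(0, 1), (2, 3), ... yields two alternating colors. The unpaired last vertex takes the third. -/
theorem hasCoronaLabeling_one_of_odd {m : ℕ} (hm : 3 ≤ m) (ho : m % 2 = 1) :
    HasCoronaLabeling m 1 3 := by
  refine ⟨fun i => if i % 2 = 0 then i / 2 + 1 else (m + 1) / 2 + 1 + i / 2,
    fun i _ => if i = m - 1 then m + 1 else if i % 2 = 0 then 2 * m - (i + 1) else 2 * m + 1 - i,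
    fun i => if i = m - 1 then (m + 1) / 2 + 1 + 2 * m else
      if i % 2 = 0 then (m + 1) / 2 + 2 * m else (m + 1) / 2 + 2 + 2 * m,
    {(m + 1) / 2 + 1 + 2 * m, (m + 1) / 2 + 2 * m, (m + 1) / 2 + 2 + 2 * m}, ?_,
    Finset.card_le_three⟩
  constructor <;>
    (try simp only [Finset.sum_range_one, Finset.mem_insert, Finset.mem_singleton]) <;> grind

/-- Same pattern, with vertex 0 exceptional: its color 3m equals its neighbors' color 5m/2 + 2
exactly when m = 4. -/
theorem hasCoronaLabeling_one_of_even {m : ℕ} (hm : 3 ≤ m) (h4 : m ≠ 4) (he : m % 2 = 0) :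
    HasCoronaLabeling m 1 3 := by
  refine ⟨fun i => if i % 2 = 0 then i / 2 + 1 else m / 2 + 1 + i / 2,
    fun i _ => if i % 2 = 0 then 2 * m - (i + 1) else 2 * m + 1 - i,
    fun i => if i = 0 then m / 2 + m / 2 + 2 * m else
      if i % 2 = 0 then m / 2 + 2 * m else m / 2 + 2 + 2 * m,
    {m / 2 + m / 2 + 2 * m, m / 2 + 2 * m, m / 2 + 2 + 2 * m}, ?_, Finset.card_le_three⟩
  constructor <;>
    (try simp only [Finset.sum_range_one, Finset.mem_insert, Finset.mem_singleton]) <;> grind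

theorem hasCoronaLabeling_four_one : HasCoronaLabeling 4 1 3 := by
  refine ⟨fun i => [1, 2, 3, 5].getD i 0, fun i _ => [6, 4, 7, 8].getD i 0,
    fun i => [12, 7, 12, 16].getD i 0, {12, 7, 16}, ?_, Finset.card_le_three⟩
  constructor
  case pendant_inj =>
    intro i hi j hj i' hi' j' hj' he
    refine ⟨?_, by omega⟩
    revert i i'
    decide
  case sum_succ =>
    intro i hi
    replace hi : i < 3 := by omega
    revert i
    simp only [Finset.sum_range_one]
    decide
  case color_ne =>
    intro i hi
    replace hi : i < 3 := by omega
    revert i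
    decide
  all_goals
    try simp only [Finset.sum_range_one]
    decide

/-- Cycle sums 2i + 1 are offset by two decreasing pendant runs, the second with the pairs (1, 2),
(3, 4), ... swapped; vertex 0 takes the third color. -/
theorem hasCoronaLabeling_two_of_odd {m : ℕ} (hm : 3 ≤ m) (ho : m % 2 = 1) :
    HasCoronaLabeling m 2 3 := by
  refine ⟨fun i => i + 1,
    fun i j => if j = 0 then 3 * m - i else
      if i = 0 then 2 * m else if i % 2 = 0 then 2 * m + 1 - i else 2 * m - (i + 1),
    fun i => if i = 0 then 6 * m + 1 else if i % 2 = 0 then 5 * m + 2 else 5 * m,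
    {6 * m + 1, 5 * m + 2, 5 * m}, ?_, Finset.card_le_three⟩
  constructor <;>
    (try simp only [Finset.sum_range_succ, Finset.sum_range_zero, Finset.mem_insert,
      Finset.mem_singleton]) <;> grind

/-- The zigzag 1, m, 2, m - 1, ... has cycle sums m + 1 at odd and m + 2 at even vertices, except
m/2 + 2 at vertex 0. Giving the label 3m to vertex 0 makes up the missing m/2. -/
theorem hasCoronaLabeling_two_of_even {m : ℕ} (hm : 3 ≤ m) (he : m % 2 = 0) :
    HasCoronaLabeling m 2 2 := by
  refine ⟨fun i => if i % 2 = 0 then i / 2 + 1 else m - i / 2,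
    fun i j => if j = 0 then
        if i = 0 then 3 * m else if i % 2 = 0 then m + m / 2 + 1 + i / 2 else m + 1 + i / 2
      else
        if i = 0 then m + m / 2 + 1 else if i % 2 = 0 then 2 * m + m / 2 - i / 2 else
          3 * m - 1 - i / 2,
    fun i => if i % 2 = 0 then 5 * m + 3 else 5 * m + 1,
    {5 * m + 3, 5 * m + 1}, ?_, Finset.card_le_two⟩
  constructor <;>
    (try simp only [Finset.sum_range_succ, Finset.sum_range_zero, Finset.mem_insert,
      Finset.mem_singleton]) <;> grind

theorem hasCoronaLabeling_two_of_even_even {m n : ℕ} (hm : 3 ≤ m) (hn : 1 ≤ n)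
    (hme : m % 2 = 0) (hne : n % 2 = 0) : HasCoronaLabeling m n 2 := by
  induction n using Nat.twoStepInduction with
  | zero => omega
  | one => omega
  | more n ih _ =>
    rcases Nat.eq_zero_or_pos n with rfl | h0
    · exact hasCoronaLabeling_two_of_even hm hme
    · exact (ih h0 (by omega)).add_two (by omega)

theorem hasCoronaLabeling_three {m n : ℕ} (hm : 3 ≤ m) (hn : 1 ≤ n)
    (h : ¬ (m % 2 = 0 ∧ n % 2 = 0)) : HasCoronaLabeling m n 3 := by
  induction n using Nat.twoStepInduction with
  | zero => omega
  | one =>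
    rcases Nat.mod_two_eq_zero_or_one m with h0 | h1
    · rcases eq_or_ne m 4 with rfl | h4
      · exact hasCoronaLabeling_four_one
      · exact hasCoronaLabeling_one_of_even hm h4 h0
    · exact hasCoronaLabeling_one_of_odd hm h1
  | more n ih _ =>
    rcases Nat.eq_zero_or_pos n with rfl | h0
    · exact hasCoronaLabeling_two_of_odd hm (by omega)
    · exact (ih h0 (by omega)).add_two (by omega)

/-! ### Counting for the lower bound -/

/-- Distinct positive labels on a finite set of `k` elements have sum at least `k (k + 1) / 2`. -/
theorem card_mul_card_succ_le_two_mul_sum {ι : Type*} [DecidableEq ι] (f : ι → ℕ)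
    (hf : Function.Injective f) (hpos : ∀ i, 1 ≤ f i) (s : Finset ι) :
    s.card * (s.card + 1) ≤ 2 * ∑ i ∈ s, f i := by
  induction s using Finset.induction_on_max_value f with
  | empty => simp
  | insert a s ha hmax ih =>
    have hcard : s.card + 1 ≤ f a := by
      have h := Finset.card_le_card_of_injOn (s := insert a s) (t := Finset.Icc 1 (f a)) f
        (fun i hi => by
          rcases Finset.mem_insert.1 hi with rfl | hi
          · exact Finset.mem_Icc.2 ⟨hpos _, le_rfl⟩
          · exact Finset.mem_Icc.2 ⟨hpos _, hmax i hi⟩) hf.injOn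
      simpa [ha] using h
    rw [Finset.card_insert_of_notMem ha, Finset.sum_insert ha]
    nlinarith

section Counting

variable {m n : ℕ} [NeZero m]

/-- The induced label of the `i`-th cycle vertex of `C_m ⊙ O_n`, for a labeling of the cycle edges
(the `i`-th one joins `i` to `i + 1`) and of the pendant edges. -/
def centerLabel (l : Fin m ⊕ Fin m × Fin n → ℕ) (i : Fin m) : ℕ :=
  l (Sum.inl i) + l (Sum.inl (i - 1)) + ∑ j, l (Sum.inr (i, j))

/-- The sum of the center labels over a vertex cover `S` of the cycle: all cycle edges are counted,
those with both ends in `S` twice. -/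
theorem sum_add_sum_shift (S : Finset (Fin m)) (hS : ∀ i, i ∈ S ∨ i + 1 ∈ S) (g : Fin m → ℕ) :
    ∑ i ∈ S, (g i + g (i - 1)) = ∑ i, g i + ∑ i with i ∈ S ∧ i + 1 ∈ S, g i := by
  have h1 : ∑ i ∈ S, g (i - 1) = ∑ i, if i + 1 ∈ S then g i else 0 := by
    rw [← Finset.sum_ite_mem_eq, ← Equiv.sum_comp (Equiv.addRight (1 : Fin m))]
    simp
  rw [Finset.sum_add_distrib, h1, ← Finset.sum_ite_mem_eq S, ← Finset.sum_add_distrib,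
    Finset.sum_filter, ← Finset.sum_add_distrib]
  refine Finset.sum_congr rfl fun i _ => ?_
  have := hS i
  by_cases h : i ∈ S <;> by_cases h' : i + 1 ∈ S <;> simp_all

theorem exists_two_large_centerLabels (hn : 1 ≤ n) (l : Fin m ⊕ Fin m × Fin n → ℕ)
    (hl : Function.Injective l) (hpos : ∀ e, 1 ≤ l e)
    (hne : ∀ i, centerLabel l i ≠ centerLabel l (i + 1)) :
    ∃ i i', m * n + m < centerLabel l i ∧ m * n + m < centerLabel l i' ∧
      centerLabel l i ≠ centerLabel l i' := by
  by_contra! hcon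
  set S : Finset (Fin m) := {i | centerLabel l i ≤ m * n + m} with hSdef
  have hS (i : Fin m) : i ∈ S ∨ i + 1 ∈ S := by
    by_contra! h
    simp only [hSdef, Finset.mem_filter, Finset.mem_univ, true_and, not_le] at h
    exact hne i (hcon i (i + 1) h.1 h.2)
  set D : Finset (Fin m) := {i | i ∈ S ∧ i + 1 ∈ S} with hD
  -- Double counting with all edge weights equal to 1.
  have hcard : 2 * S.card = m + D.card := by
    have := sum_add_sum_shift S hS (fun _ => 1)
    simp only [Finset.sum_const, Finset.card_univ, Fintype.card_fin, smul_eq_mul, mul_one] at this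
    rw [← hD] at this
    omega
  have hsum : ∑ i ∈ S, centerLabel l i ≤ S.card * (m * n + m) := by
    rw [← smul_eq_mul]
    exact Finset.sum_le_card_nsmul _ _ _ fun i hi => (Finset.mem_filter.1 hi).2
  have heq : ∑ i ∈ S, centerLabel l i =
      ∑ e ∈ (Finset.univ : Finset (Fin m)).disjSum (S ×ˢ (Finset.univ : Finset (Fin n))), l e +
        ∑ i ∈ D, l (Sum.inl i) := by
    rw [Finset.sum_disjSum, Finset.sum_product]
    simp only [centerLabel]
    rw [Finset.sum_add_distrib, sum_add_sum_shift S hS fun i => l (Sum.inl i)]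
    ring
  have h1 := card_mul_card_succ_le_two_mul_sum l hl hpos
    ((Finset.univ : Finset (Fin m)).disjSum (S ×ˢ (Finset.univ : Finset (Fin n))))
  have h2 := card_mul_card_succ_le_two_mul_sum (fun i : Fin m => l (Sum.inl i))
    (hl.comp Sum.inl_injective) (fun i => hpos _) D
  simp only [Finset.card_disjSum, Finset.card_product, Finset.card_univ, Fintype.card_fin] at h1
  have hm : 0 < m := Nat.pos_of_neZero m
  have hfin : (m + S.card * n) * (m + S.card * n + 1) + D.card * (D.card + 1) ≤
      2 * (S.card * (m * n + m)) := by linarith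
  generalize S.card = k at hfin hcard
  generalize D.card = d at hfin hcard
  zify at hfin hcard hm hn
  have hd : (d : ℤ) = 2 * k - m := by linarith
  rw [hd] at hfin
  -- With d = 2k - m, `hfin` reads 2m² + k²n² + 4k² - 6km + kn + 2k ≤ 0. Since n ≥ 1, the left side
  -- is at least 2m² + 5k² - 6km = ((5k - 3m)² + m²)/5 > 0.
  have h3 : (0 : ℤ) ≤ (k : ℤ) ^ 2 * ((n : ℤ) ^ 2 - 1) :=
    mul_nonneg (sq_nonneg _) (by nlinarith)
  nlinarith [sq_nonneg (5 * (k : ℤ) - 3 * m), mul_nonneg (Nat.cast_nonneg (α := ℤ) k)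
    (Nat.cast_nonneg (α := ℤ) n)]

end Counting


/-! ### From edge labelings to the corona graph -/

namespace SimpleGraph

section CycleCorona

variable {m n : ℕ} [NeZero m]

/-- The edges of `C_m ⊙ O_n`: the cycle edges `{i, i + 1}` and the pendant edges. -/
def cycleCoronaEdge (m n : ℕ) [NeZero m] :
    Fin m ⊕ Fin m × Fin n → Sym2 (Fin m ⊕ Fin m × Fin n)
  | Sum.inl i => s(Sum.inl i, Sum.inl (i + 1))
  | Sum.inr q => s(Sum.inl q.1, Sum.inr q)

theorem cycleGraph_adj_iff_eq_add_one (hm : 3 ≤ m) {u v : Fin m} :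
    (cycleGraph m).Adj u v ↔ v = u + 1 ∨ u = v + 1 := by
  have h1 (w : Fin m) : w.val = 1 ↔ w = 1 := by
    rw [Fin.ext_iff, Fin.val_one', Nat.mod_eq_of_lt (by omega)]
  rw [cycleGraph_adj', h1, h1, sub_eq_iff_eq_add', sub_eq_iff_eq_add', or_comm]

/-- This keeps the m cycle edges distinct: for m = 2 the pairs {0, 1} and {1, 0} would coincide. -/
theorem add_one_add_one_ne (hm : 3 ≤ m) (i : Fin m) : i + 1 + 1 ≠ i := by
  intro h
  rw [add_assoc, add_eq_left] at h
  have := congrArg Fin.val h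
  rw [Fin.val_add, Fin.val_one', Nat.mod_eq_of_lt (by omega : 1 < m), Fin.val_zero,
    Nat.mod_eq_of_lt (by omega)] at this
  omega

theorem add_one_ne_self (hm : 3 ≤ m) (i : Fin m) : i + 1 ≠ i := by
  intro h
  exact add_one_add_one_ne hm i (by rw [h, h])

theorem cycleCoronaEdge_injective (hm : 3 ≤ m) : Function.Injective (cycleCoronaEdge m n) := by
  rintro (i | q) (i' | q') h
  · simp only [cycleCoronaEdge, Sym2.eq_iff, Sum.inl.injEq] at h
    rcases h with h | ⟨h1, h2⟩
    · rw [h.1]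
    · rw [h1] at h2
      exact absurd h2 (add_one_add_one_ne hm i')
  all_goals simp_all [cycleCoronaEdge]

theorem range_cycleCoronaEdge (hm : 3 ≤ m) : Set.range (cycleCoronaEdge m n) =
    ((cycleGraph m).corona (⊥ : SimpleGraph (Fin n))).edgeSet := by
  ext e
  constructor
  · rintro ⟨i | q, rfl⟩
    · exact (cycleGraph_adj_iff_eq_add_one hm).2 (Or.inl rfl)
    · exact rfl
  · induction e using Sym2.ind with
    | _ u v =>
      rintro h
      rcases u with u | q <;> rcases v with v | q'
      · rcases (cycleGraph_adj_iff_eq_add_one hm).1 h with rfl | rfl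
        · exact ⟨Sum.inl u, rfl⟩
        · exact ⟨Sum.inl v, Sym2.eq_swap⟩
      · obtain rfl : u = q'.1 := h
        exact ⟨Sum.inr q', rfl⟩
      · obtain rfl : q.1 = v := h
        exact ⟨Sum.inr q, Sym2.eq_swap⟩
      · exact absurd h.2 id

theorem ncard_edgeSet_cycleCorona (hm : 3 ≤ m) :
    ((cycleGraph m).corona (⊥ : SimpleGraph (Fin n))).edgeSet.ncard = m * n + m := by
  rw [← range_cycleCoronaEdge hm, ← Set.image_univ,
    Set.ncard_image_of_injective _ (cycleCoronaEdge_injective hm), Set.ncard_univ]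
  simp [add_comm]

open Classical in
theorem inducedLabel_cycleCorona (hm : 3 ≤ m) (f : Sym2 (Fin m ⊕ Fin m × Fin n) → ℕ)
    (v : Fin m ⊕ Fin m × Fin n) :
    ((cycleGraph m).corona (⊥ : SimpleGraph (Fin n))).inducedLabel f v =
      ∑ e with v ∈ cycleCoronaEdge m n e, f (cycleCoronaEdge m n e) := by
  rw [inducedLabel, ← Finset.sum_image (cycleCoronaEdge_injective hm).injOn]
  refine Finset.sum_congr ?_ fun _ _ => rfl
  ext e
  simp only [mem_incidenceFinset, incidenceSet, ← range_cycleCoronaEdge hm, Set.mem_ofPred_eq,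
    Set.mem_range, Finset.mem_image, Finset.mem_filter, Finset.mem_univ, true_and]
  constructor
  · rintro ⟨⟨a, rfl⟩, h⟩
    exact ⟨a, h, rfl⟩
  · rintro ⟨a, h, rfl⟩
    exact ⟨⟨a, rfl⟩, h⟩

theorem inducedLabel_inr (hm : 3 ≤ m) (f : Sym2 (Fin m ⊕ Fin m × Fin n) → ℕ)
    (q : Fin m × Fin n) :
    ((cycleGraph m).corona (⊥ : SimpleGraph (Fin n))).inducedLabel f (Sum.inr q) =
      f (cycleCoronaEdge m n (Sum.inr q)) := by
  classical
  rw [inducedLabel_cycleCorona hm, Finset.sum_eq_single_of_mem (Sum.inr q)]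
  · rw [Finset.mem_filter]
    simp [cycleCoronaEdge]
  · rintro (i | q') h hne <;> rw [Finset.mem_filter] at h
    · simp [cycleCoronaEdge] at h
    · simp_all [cycleCoronaEdge]

theorem inducedLabel_inl (hm : 3 ≤ m) (f : Sym2 (Fin m ⊕ Fin m × Fin n) → ℕ) (i : Fin m) :
    ((cycleGraph m).corona (⊥ : SimpleGraph (Fin n))).inducedLabel f (Sum.inl i) =
      centerLabel (f ∘ cycleCoronaEdge m n) i := by
  classical
  have hne : i ≠ i - 1 := fun h => add_one_ne_self hm i (by
    conv_lhs => rw [h]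
    rw [sub_add_cancel])
  have hset : (Finset.univ.filter fun e => Sum.inl i ∈ cycleCoronaEdge m n e) =
      ({i, i - 1} : Finset (Fin m)).disjSum (({i} : Finset (Fin m)) ×ˢ Finset.univ) := by
    ext (j | ⟨j, k⟩)
    · rw [Finset.mem_filter]
      simp [cycleCoronaEdge, eq_sub_iff_add_eq, eq_comm]
    · rw [Finset.mem_filter]
      simp [cycleCoronaEdge, eq_comm]
  rw [inducedLabel_cycleCorona hm, hset, Finset.sum_disjSum, Finset.sum_pair hne,
    Finset.sum_product, Finset.sum_singleton]
  rfl

theorem le_localAntimagicChromaticNumber_cycleCorona (hm : 3 ≤ m) (hn : 1 ≤ n) :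
    ((m * n + 2 : ℕ) : ℕ∞) ≤ ((cycleGraph m).corona
      (⊥ : SimpleGraph (Fin n))).localAntimagicChromaticNumber := by
  refine le_iInf₂ fun f hf => ?_
  obtain ⟨hbij, hadj⟩ := hf
  rw [Nat.cast_le]
  have hmem (e) : cycleCoronaEdge m n e ∈
      ((cycleGraph m).corona (⊥ : SimpleGraph (Fin n))).edgeSet :=
    range_cycleCoronaEdge (n := n) hm ▸ Set.mem_range_self e
  set l := f ∘ cycleCoronaEdge m n
  have hl : Function.Injective l := fun a b h =>
    cycleCoronaEdge_injective hm (hbij.injOn (hmem a) (hmem b) h)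
  have hrange (e) : 1 ≤ l e ∧ l e ≤ m * n + m := by
    have := hbij.mapsTo (hmem e)
    rwa [ncard_edgeSet_cycleCorona hm] at this
  obtain ⟨i, i', hi, hi', hne⟩ := exists_two_large_centerLabels hn l hl (fun e => (hrange e).1)
    fun i => by
      rw [← inducedLabel_inl hm, ← inducedLabel_inl hm]
      exact hadj _ _ (hmem (Sum.inl i))
  have hlarge (j) (hj : m * n + m < centerLabel l j) :
      centerLabel l j ∉ Finset.univ.image fun q => l (Sum.inr q) := by
    simp only [Finset.mem_image, Finset.mem_univ, true_and, not_exists]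
    intro q hq
    have := (hrange (Sum.inr q)).2
    omega
  have hcard : (insert (centerLabel l i) (insert (centerLabel l i')
      (Finset.univ.image fun q => l (Sum.inr q)))).card = m * n + 2 := by
    rw [Finset.card_insert_of_notMem, Finset.card_insert_of_notMem (hlarge i' hi'),
      Finset.card_image_of_injective _ fun q q' h => Sum.inr_injective (hl h)]
    · simp
    · rw [Finset.mem_insert, not_or]
      exact ⟨hne, hlarge i hi⟩
  rw [← hcard, colorNumber, ← Set.ncard_coe_finset]
  refine Set.ncard_le_ncard ?_ (Set.finite_range _)
  intro a ha
  simp only [Finset.coe_insert, Finset.coe_image, Finset.coe_univ, Set.image_univ,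
    Set.mem_insert_iff, Set.mem_range] at ha
  rcases ha with rfl | rfl | ⟨q, rfl⟩
  · exact ⟨Sum.inl i, inducedLabel_inl hm f i⟩
  · exact ⟨Sum.inl i', inducedLabel_inl hm f i'⟩
  · exact ⟨Sum.inr q, inducedLabel_inr hm f q⟩

/-- A labeling of the edges of `C_m ⊙ O_n` by distinct labels in `{1, …, |E|}` whose center labels
properly color the cycle with colors from `K` bounds the local antimagic chromatic number. -/
theorem localAntimagicChromaticNumber_cycleCorona_le (hm : 3 ≤ m)
    (l : Fin m ⊕ Fin m × Fin n → ℕ) (hl : Function.Injective l)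
    (hrange : ∀ e, 1 ≤ l e ∧ l e ≤ m * n + m)
    (hne : ∀ i, centerLabel l (i + 1) ≠ centerLabel l i) (K : Finset ℕ)
    (hK : ∀ i, centerLabel l i ∈ K) :
    ((cycleGraph m).corona (⊥ : SimpleGraph (Fin n))).localAntimagicChromaticNumber ≤
      ((m * n + K.card : ℕ) : ℕ∞) := by
  set f : Sym2 (Fin m ⊕ Fin m × Fin n) → ℕ := Function.extend (cycleCoronaEdge m n) l 0
  have hfe (e) : f (cycleCoronaEdge m n e) = l e :=
    (cycleCoronaEdge_injective hm).extend_apply l 0 e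
  have hfl : f ∘ cycleCoronaEdge m n = l := funext hfe
  -- Strict because a center also meets cycle edges, whose labels are positive.
  have hlt (q : Fin m × Fin n) : l (Sum.inr q) < centerLabel l q.1 := by
    have h1 := (hrange (Sum.inl q.1)).1
    have h2 : l (Sum.inr (q.1, q.2)) ≤ ∑ j, l (Sum.inr (q.1, j)) :=
      Finset.single_le_sum (f := fun j => l (Sum.inr (q.1, j))) (fun _ _ => Nat.zero_le _)
        (Finset.mem_univ q.2)
    rw [centerLabel]
    exact h2.trans_lt (by omega)
  -- Surjectivity is automatic: there are as many edges as labels.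
  have himage : l '' Set.univ = Set.Icc 1 (m * n + m) := by
    have h : Finset.univ.image l = Finset.Icc 1 (m * n + m) := by
      refine Finset.eq_of_subset_of_card_le ?_ ?_
      · intro a ha
        obtain ⟨e, -, rfl⟩ := Finset.mem_image.1 ha
        exact Finset.mem_Icc.2 (hrange e)
      · rw [Finset.card_image_of_injective _ hl]
        simp [add_comm]
    rw [← Finset.coe_univ, ← Finset.coe_image, h, Finset.coe_Icc]
  have hanti : ((cycleGraph m).corona (⊥ : SimpleGraph (Fin n))).IsLocalAntimagicLabeling f := by
    constructor
    · rw [ncard_edgeSet_cycleCorona hm, ← range_cycleCoronaEdge hm, ← himage, ← hfl,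
        Set.image_comp, Set.image_univ]
      refine Set.InjOn.bijOn_image ?_
      rintro _ ⟨a, rfl⟩ _ ⟨b, rfl⟩ h
      rw [hfe, hfe] at h
      rw [hl h]
    · rintro (u | q) (v | q') h
      · rw [inducedLabel_inl hm, inducedLabel_inl hm, hfl]
        rcases (cycleGraph_adj_iff_eq_add_one hm).1 h with rfl | rfl
        · exact (hne u).symm
        · exact hne v
      · obtain rfl : u = q'.1 := h
        rw [inducedLabel_inl hm, inducedLabel_inr hm, hfl, hfe]
        exact (hlt q').ne'
      · obtain rfl : q.1 = v := h
        rw [inducedLabel_inl hm, inducedLabel_inr hm, hfl, hfe]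
        exact (hlt q).ne
      · exact absurd h.2 id
  refine (iInf₂_le f hanti).trans (Nat.cast_le.2 ?_)
  have hsub : Set.range (((cycleGraph m).corona (⊥ : SimpleGraph (Fin n))).inducedLabel f) ⊆
      ((Finset.univ.image fun q => l (Sum.inr q)) ∪ K : Finset ℕ) := by
    rintro _ ⟨i | q, rfl⟩
    · rw [inducedLabel_inl hm, hfl]
      exact Finset.mem_coe.2 (Finset.mem_union_right _ (hK i))
    · rw [inducedLabel_inr hm, hfe]
      exact Finset.mem_coe.2 (Finset.mem_union_left _
        (Finset.mem_image_of_mem _ (Finset.mem_univ q)))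
  calc _ ≤ _ := Set.ncard_le_ncard hsub (Finset.finite_toSet _)
    _ ≤ _ := by
      rw [Set.ncard_coe_finset]
      refine (Finset.card_union_le _ _).trans (Nat.add_le_add_right ?_ _)
      exact Finset.card_image_le.trans (by simp)

theorem localAntimagicChromaticNumber_le_of_hasCoronaLabeling {k : ℕ} (hm : 3 ≤ m)
    (h : HasCoronaLabeling m n k) :
    ((cycleGraph m).corona (⊥ : SimpleGraph (Fin n))).localAntimagicChromaticNumber ≤
      ((m * n + k : ℕ) : ℕ∞) := by
  obtain ⟨x, p, c, K, h, hK⟩ := h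
  let l : Fin m ⊕ Fin m × Fin n → ℕ := Sum.elim (fun i => x i) fun q => p q.1 q.2
  have hsucc (i : ℕ) (hi : i + 1 < m) : (⟨i + 1, hi⟩ : Fin m) = ⟨i, by omega⟩ + 1 := by
    rw [Fin.ext_iff, Fin.val_add, Fin.val_one', Nat.mod_eq_of_lt (by omega : 1 < m),
      Nat.mod_eq_of_lt hi]
  have hzero : (0 : Fin m) = ⟨m - 1, by omega⟩ + 1 := by
    rw [Fin.ext_iff, Fin.val_add, Fin.val_one', Nat.mod_eq_of_lt (by omega : 1 < m),
      Nat.sub_add_cancel (by omega), Nat.mod_self, Fin.val_zero]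
  have hlc (i : Fin m) : centerLabel l i = c i := by
    obtain ⟨i, hi⟩ := i
    have hs : ∑ j : Fin n, l (Sum.inr (⟨i, hi⟩, j)) = ∑ j ∈ Finset.range n, p i j :=
      Fin.sum_univ_eq_sum_range (p i) n
    rw [centerLabel, hs]
    rcases i with _ | i
    · have h0 : (⟨0, hi⟩ : Fin m) - 1 = ⟨m - 1, by omega⟩ := sub_eq_iff_eq_add.2 hzero
      rw [h0]
      exact h.sum_zero
    · rw [sub_eq_iff_eq_add.2 (hsucc i hi)]
      exact h.sum_succ i hi
  refine (localAntimagicChromaticNumber_cycleCorona_le hm l ?_ ?_ ?_ K ?_).trans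
    (Nat.cast_le.2 (Nat.add_le_add_left hK _))
  · rintro (i | ⟨i, j⟩) (i' | ⟨i', j'⟩) he
    · exact congrArg Sum.inl (Fin.ext (h.cycle_inj i i.2 i' i'.2 he))
    · exact absurd he (h.cycle_ne_pendant i i.2 i' i'.2 j' j'.2)
    · exact absurd he.symm (h.cycle_ne_pendant i' i'.2 i i.2 j j.2)
    · obtain ⟨h1, h2⟩ := h.pendant_inj i i.2 j j.2 i' i'.2 j' j'.2 he
      rw [Fin.ext h1, Fin.ext h2]
  · rintro (i | ⟨i, j⟩)
    · exact h.cycle_mem i i.2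
    · exact h.pendant_mem i i.2 j j.2
  · rintro ⟨i, hi⟩
    rw [hlc, hlc]
    by_cases h1 : i + 1 < m
    · rw [← hsucc i h1]
      exact h.color_ne i h1
    · obtain rfl : i = m - 1 := by omega
      rw [← hzero]
      exact h.color_ne_last
  · intro i
    rw [hlc]
    exact h.color_mem i i.2

end CycleCorona

end SimpleGraph

/-- `C_m` is the cycle of order `m`, and `O_n` is the null (edgeless) graph of order `n`. -/
theorem mainTheorem4 (m n : ℕ) (hm : 3 ≤ m) (hn : 1 ≤ n) :
    ((Even m ∧ Even n) →
      ((SimpleGraph.cycleGraph m).corona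
        (⊥ : SimpleGraph (Fin n))).localAntimagicChromaticNumber = ((m * n + 2 : ℕ) : ℕ∞)) ∧
    (¬ (Even m ∧ Even n) →
      ((m * n + 2 : ℕ) : ℕ∞) ≤ ((SimpleGraph.cycleGraph m).corona
        (⊥ : SimpleGraph (Fin n))).localAntimagicChromaticNumber ∧
      ((SimpleGraph.cycleGraph m).corona
        (⊥ : SimpleGraph (Fin n))).localAntimagicChromaticNumber ≤ ((m * n + 3 : ℕ) : ℕ∞)) := by
  have : NeZero m := ⟨by omega⟩
  have hlower := SimpleGraph.le_localAntimagicChromaticNumber_cycleCorona hm hn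
  refine ⟨fun h => le_antisymm ?_ hlower, fun h => ⟨hlower, ?_⟩⟩
  · exact SimpleGraph.localAntimagicChromaticNumber_le_of_hasCoronaLabeling hm
      (hasCoronaLabeling_two_of_even_even hm hn (Nat.even_iff.1 h.1) (Nat.even_iff.1 h.2))
  · rw [Nat.even_iff, Nat.even_iff] at h
    exact SimpleGraph.localAntimagicChromaticNumber_le_of_hasCoronaLabeling hm
      (hasCoronaLabeling_three hm hn h)
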